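/- Let $k\ge 3$ be an integer and let $\varepsilon>0$. There is an $n_0=n_0(k,\varepsilon)$ such that the following holds for all $n\ge n_0$. Let $H$ be a $k$-uniform hypergraph on a finite vertex set $V(H)$ with $n$ vertices (every edge is a $k$-element subset of $V(H)$), and suppose that every vertex of $H$ lies in at least one edge. Write $\deg(u)$ for the number of edges containing $u$, and suppose that $$\deg(u)+\deg(v)>(1+2\varepsilon)\binom{n}{k-1}$$ for any two distinct vertices $u,v$ that are contained in a common edge of $H$. A matching is a set of pairwise disjoint edges of $H$, and $V(M)$ denotes the set of vertices covered by a matching $M$. Then $H$ has a matching $M$ with $|M|\le\varepsilon^{4k+1}n$ such that for every set $V'\subseteq V(H)\setminus V(M)$ with $|V'|\le\varepsilon^{8k+2}n$ and $|V'|\equiv 0\pmod k$ there is a matching $M'$ in $H$ with $V(M')=V(M)\cup V'$. -/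

import Mathlib

namespace Hypergraph

/-- Every edge has exactly `k` vertices. (For `k = 0` an infinite edge would have `ncard = 0`;
on finite vertex sets, or for `0 < k`, there is no such case.) -/
def IsUniform {α : Type*} (H : Hypergraph α) (k : ℕ) : Prop :=
  ∀ e ∈ H.edgeSet, e.ncard = k

/-- The number of edges containing the vertex `v`. -/
noncomputable def degree {α : Type*} (H : Hypergraph α) (v : α) : ℕ :=
  {e ∈ H.edgeSet | v ∈ e}.ncard

/-- A matching is a family of pairwise disjoint edges. The vertex set that it covers is `⋃₀ M`. -/
def IsMatching {α : Type*} (H : Hypergraph α) (M : Set (Set α)) : Prop :=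
  M ⊆ H.edgeSet ∧ M.PairwiseDisjoint id

end Hypergraph

/-! The proof uses the absorbing method. Let k = m + 1 and η = 3ε/2. A k × k array absorbs a k-tuple
`v` if its rows and its first column are edges and each row remains an edge when its first entry is
replaced by `v i`. The rows then match the array alone, while the first column and the modified rows
match the array together with `v`.

In terms of ordered tuples, the degree condition says that the links of adjacent vertices meet in at
least η n^m tuples. Building first columns (`le_card_transversalTuples`) and then rows gives at
least η^(k+2) n^(k²) absorbing arrays for every `v` (`le_card_absorbingArrays`).

A derandomized greedy choice (`exists_greedy_disjoint_family`) takes the place of random sampling.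
Write c = ε^(4k+1). With δ = 3c and at most cn/k disjoint arrays chosen, the potential falls from
n^k to at most 2^(-t) for t = ⌊c²n/k⌋, so every tuple keeps at least t absorbing arrays. Hall's
theorem then assigns distinct arrays to the tuples into which V' is cut. -/

/-! ### Derandomized greedy selection -/

/-- Greedy selection of pairwise disjoint sets, driven by the potential `∑ q, 2 ^ (-#(F ∩ A q))`. -/
theorem exists_greedy_disjoint_family {Ω V Q : Type*} [Fintype Ω] [DecidableEq Ω] [Nonempty Ω]
    [DecidableEq V] [Fintype Q] (A : Q → Finset Ω) (s : Ω → Finset V)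
    (hs : ∀ ω, (s ω).Nonempty) {b N : ℕ} (hb : ∀ ω, (s ω).card ≤ b) {δ : ℝ} (hδ : δ ≤ 1)
    (h : ∀ U : Finset V, U.card ≤ N * b → ∀ q,
      δ * Fintype.card Ω ≤ (((A q).filter fun ω => Disjoint (s ω) U).card : ℝ)) :
    ∀ t ≤ N, ∃ F : Finset Ω, F.card ≤ t ∧ (∀ ω ∈ F, ∃ q, ω ∈ A q) ∧
      (F : Set Ω).PairwiseDisjoint s ∧
      ∑ q, (1 / 2 : ℝ) ^ (F ∩ A q).card ≤ Fintype.card Q * (1 - δ / 2) ^ t := by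
  classical
  intro t
  induction t with
  | zero =>
    intro _
    refine ⟨∅, by simp, by simp, by simp, by simp⟩
  | succ t ih =>
    intro ht
    obtain ⟨F, hFc, hFA, hFd, hFs⟩ := ih (by omega)
    set U := F.biUnion s with hU
    have hUc : U.card ≤ N * b :=
      (Finset.card_biUnion_le_card_mul _ _ _ fun ω _ => hb ω).trans
        (Nat.mul_le_mul_right _ (by omega))
    -- A clashing or useless choice leaves `F` unchanged, so no term of the potential ever grows.
    set new : Ω → Finset Ω := fun ω =>
      if Disjoint (s ω) U ∧ ∃ q, ω ∈ A q then insert ω F else F with hnew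
    have hnotmem : ∀ ω, Disjoint (s ω) U → ω ∉ F := by
      intro ω hω hF
      obtain ⟨x, hx⟩ := hs ω
      exact Finset.disjoint_left.1 hω hx (Finset.mem_biUnion.2 ⟨ω, hF, hx⟩)
    -- At least a fraction δ of all `ω` halve the term of `q`, so on average it shrinks by the
    -- factor 1 - δ/2. Summing over `q` yields one `ω` that works for the total.
    have key : ∀ q, ∑ ω, (1 / 2 : ℝ) ^ (new ω ∩ A q).card ≤
        (1 / 2 : ℝ) ^ (F ∩ A q).card * (Fintype.card Ω * (1 - δ / 2)) := by
      intro q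
      have hpt : ∀ ω, (1 / 2 : ℝ) ^ (new ω ∩ A q).card ≤ (1 / 2 : ℝ) ^ (F ∩ A q).card *
          (1 - if ω ∈ (A q).filter fun ω => Disjoint (s ω) U then 1 / 2 else 0) := by
        intro ω
        by_cases hω : ω ∈ (A q).filter fun ω => Disjoint (s ω) U
        · rw [if_pos hω]
          rw [Finset.mem_filter] at hω
          have : new ω = insert ω F := by
            simp only [hnew]
            rw [if_pos ⟨hω.2, q, hω.1⟩]
          rw [this, Finset.insert_inter_of_mem hω.1, Finset.card_insert_of_notMem
            (fun hm => hnotmem ω hω.2 (Finset.mem_inter.1 hm).1), pow_succ]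
          norm_num
        · rw [if_neg hω, sub_zero, mul_one]
          apply pow_le_pow_of_le_one (by norm_num) (by norm_num)
          apply Finset.card_le_card
          apply Finset.inter_subset_inter_right
          simp only [hnew]
          split_ifs
          · exact Finset.subset_insert _ _
          · exact subset_rfl
      refine (Finset.sum_le_sum fun ω _ => hpt ω).trans ?_
      rw [← Finset.mul_sum]
      apply mul_le_mul_of_nonneg_left _ (by positivity)
      rw [Finset.sum_sub_distrib, ← Finset.sum_filter]
      simp only [Finset.sum_const, Finset.filter_univ_mem, Finset.card_univ, nsmul_eq_mul, mul_one]
      have := h U hUc q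
      linarith
    have hsum : ∑ ω, ∑ q, (1 / 2 : ℝ) ^ (new ω ∩ A q).card ≤
        ∑ _ω : Ω, (1 - δ / 2) * ∑ q, (1 / 2 : ℝ) ^ (F ∩ A q).card := by
      rw [Finset.sum_comm]
      refine (Finset.sum_le_sum fun q _ => key q).trans (le_of_eq ?_)
      rw [← Finset.sum_mul]
      simp only [Finset.sum_const, Finset.card_univ, nsmul_eq_mul]
      ring
    obtain ⟨ω, -, hω⟩ := Finset.exists_le_of_sum_le Finset.univ_nonempty hsum
    have hfin : ∑ q, (1 / 2 : ℝ) ^ (new ω ∩ A q).card ≤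
        Fintype.card Q * (1 - δ / 2) ^ (t + 1) := by
      refine hω.trans ?_
      calc _ ≤ (1 - δ / 2) * (Fintype.card Q * (1 - δ / 2) ^ t) :=
            mul_le_mul_of_nonneg_left hFs (by linarith)
        _ = _ := by ring
    by_cases hc : Disjoint (s ω) U ∧ ∃ q, ω ∈ A q
    · have hn : new ω = insert ω F := by
        simp only [hnew]
        rw [if_pos hc]
      rw [hn] at hfin
      refine ⟨insert ω F, (Finset.card_insert_le _ _).trans (by omega), ?_, ?_, hfin⟩
      · intro x hx
        rcases Finset.mem_insert.1 hx with rfl | hx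
        · exact hc.2
        · exact hFA x hx
      · rw [Finset.coe_insert]
        refine hFd.insert fun x hx _ => ?_
        exact hc.1.mono_right (Finset.subset_biUnion_of_mem s (Finset.mem_coe.1 hx))
    · have hn : new ω = F := by
        simp only [hnew]
        rw [if_neg hc]
      rw [hn] at hfin
      exact ⟨F, by omega, hFA, hFd, hfin⟩

/-! ### Counting degenerate functions -/

/-- Exchanging the value `f a` with a free vertex `x` loses no information. -/
theorem card_filter_apply_mem_mul_card_le {ι V : Type*} [Fintype ι] [DecidableEq ι] [Fintype V]
    [DecidableEq V] (a : ι) (U : Finset V) :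
    (Finset.univ.filter fun f : ι → V => f a ∈ U).card * Fintype.card V ≤
      U.card * Fintype.card V ^ Fintype.card ι := by
  rw [← Fintype.card_fun, ← Finset.card_univ, ← Finset.card_univ, ← Finset.card_product,
    ← Finset.card_product]
  refine Finset.card_le_card_of_injOn (fun p => (p.1 a, Function.update p.1 a p.2)) ?_ ?_
  · rintro ⟨f, x⟩ hf
    simpa using hf
  · rintro ⟨f, x⟩ _ ⟨g, y⟩ _ hfg
    simp only [Prod.mk.injEq] at hfg
    obtain ⟨h1, h2⟩ := hfg
    have hx : x = y := by simpa using congrFun h2 a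
    refine Prod.ext (funext fun i => ?_) hx
    by_cases hi : i = a
    · rw [hi]; exact h1
    · simpa [hi] using congrFun h2 i

/-- As `f a` is recovered from `f b`, coordinate `a` is free to store a vertex. -/
theorem card_filter_apply_eq_mul_card_le {ι V : Type*} [Fintype ι] [DecidableEq ι] [Fintype V]
    [DecidableEq V] {a b : ι} (hab : a ≠ b) :
    (Finset.univ.filter fun f : ι → V => f a = f b).card * Fintype.card V ≤
      Fintype.card V ^ Fintype.card ι := by
  rw [← Fintype.card_fun, ← Finset.card_univ, ← Finset.card_univ, ← Finset.card_product]
  refine Finset.card_le_card_of_injOn (fun p => Function.update p.1 a p.2) (by simp) ?_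
  rintro ⟨f, x⟩ hf ⟨g, y⟩ hg h2
  simp only [Finset.coe_product, Finset.coe_filter, Finset.mem_univ, true_and, Finset.coe_univ,
    Set.mem_prod, Set.mem_ofPred_eq, Set.mem_univ, and_true] at hf hg h2
  have hx : x = y := by simpa using congrFun h2 a
  refine Prod.ext (funext fun i => ?_) hx
  have hne : ∀ i, i ≠ a → f i = g i := fun i hi => by simpa [hi] using congrFun h2 i
  by_cases hi : i = a
  · subst hi
    change f i = g i
    rw [hf, hg]; exact hne b hab.symm
  · exact hne i hi

/-- Few functions fail to be injective or have a value in a given small set. -/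
theorem card_filter_not_injective_or_mem_mul_card_le {ι V : Type*} [Fintype ι] [DecidableEq ι]
    [Fintype V] [DecidableEq V] (U : Finset V) :
    (Finset.univ.filter fun f : ι → V =>
        ¬ (Function.Injective f ∧ ∀ a, f a ∉ U)).card * Fintype.card V ≤
      (Fintype.card ι ^ 2 + Fintype.card ι * U.card) * Fintype.card V ^ Fintype.card ι := by
  classical
  have hsub : (Finset.univ.filter fun f : ι → V => ¬ (Function.Injective f ∧ ∀ a, f a ∉ U)) ⊆
      ((Finset.univ : Finset (ι × ι)).filter (fun p => p.1 ≠ p.2)).biUnion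
        (fun p => Finset.univ.filter fun f : ι → V => f p.1 = f p.2) ∪
      (Finset.univ : Finset ι).biUnion (fun a => Finset.univ.filter fun f : ι → V => f a ∈ U) := by
    intro f hf
    simp only [Finset.mem_filter, Finset.mem_univ, true_and, Finset.mem_union, Finset.mem_biUnion,
      Prod.exists] at hf ⊢
    by_cases hi : Function.Injective f
    · right
      by_contra! hc
      exact hf ⟨hi, hc⟩
    · left
      simp only [Function.Injective, not_forall] at hi
      obtain ⟨a, b, h1, h2⟩ := hi
      exact ⟨a, b, h2, h1⟩
  refine (Nat.mul_le_mul_right _ ((Finset.card_le_card hsub).trans (Finset.card_union_le _ _))).trans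
    ?_
  rw [add_mul, add_mul]
  apply add_le_add
  · refine (Nat.mul_le_mul_right _ Finset.card_biUnion_le).trans ?_
    rw [Finset.sum_mul]
    refine (Finset.sum_le_card_nsmul _ _ (Fintype.card V ^ Fintype.card ι) ?_).trans ?_
    · intro p hp
      exact card_filter_apply_eq_mul_card_le (Finset.mem_filter.1 hp).2
    · rw [smul_eq_mul]
      apply Nat.mul_le_mul_right
      refine (Finset.card_filter_le _ _).trans ?_
      simp [sq]
  · refine (Nat.mul_le_mul_right _ Finset.card_biUnion_le).trans ?_
    rw [Finset.sum_mul]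
    refine (Finset.sum_le_card_nsmul _ _ (U.card * Fintype.card V ^ Fintype.card ι) ?_).trans ?_
    · intro p _
      exact card_filter_apply_mem_mul_card_le p U
    · simp [mul_assoc]

/-! ### Links, neighborhoods and the number of absorbing arrays -/

namespace Hypergraph

variable {α : Type*} (H : Hypergraph α) [Fintype H.vertexSet]

open Classical in
/-- The `m`-tuples of vertices that together with `v` form an edge. -/
noncomputable def linkTuples (m : ℕ) (v : α) : Finset (Fin m → H.vertexSet) :=
  Finset.univ.filter fun f => insert v (Set.range fun i => (f i : α)) ∈ H.edgeSet

open Classical in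
/-- The vertices other than `v` that are adjacent to `v`. -/
noncomputable def neighbors (v : α) : Finset H.vertexSet :=
  Finset.univ.filter fun u => (u : α) ≠ v ∧ H.Adj v u

open Classical in
/-- The tuples that form an edge and whose `i`-th entry is a neighbor of `v i`. -/
noncomputable def transversalTuples {k : ℕ} (v : Fin k → H.vertexSet) :
    Finset (Fin k → H.vertexSet) :=
  Finset.univ.filter fun g =>
    (∀ i, g i ∈ H.neighbors (v i)) ∧ (Set.range fun i => (g i : α)) ∈ H.edgeSet

open Classical in
/-- Square arrays of vertices whose first column is a transversal tuple for `v`, and in which the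
rest of the `i`-th row completes both `v i` and the first entry of the row to an edge. -/
noncomputable def absorbingArrays {m : ℕ} (v : Fin (m + 1) → H.vertexSet) :
    Finset (Fin (m + 1) × Fin (m + 1) → H.vertexSet) :=
  Finset.univ.filter fun ω =>
    (fun i => ω (i, 0)) ∈ H.transversalTuples v ∧
      ∀ i, (fun j : Fin m => ω (i, j.succ)) ∈
        H.linkTuples m (v i) ∩ H.linkTuples m (ω (i, 0))

variable {H}

theorem mem_linkTuples {m : ℕ} {v : α} {f : Fin m → H.vertexSet} :
    f ∈ H.linkTuples m v ↔ insert v (Set.range fun i => (f i : α)) ∈ H.edgeSet := by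
  simp [linkTuples]

theorem mem_neighbors {v : α} {u : H.vertexSet} :
    u ∈ H.neighbors v ↔ (u : α) ≠ v ∧ H.Adj v u := by
  simp [neighbors]

theorem mem_transversalTuples {k : ℕ} {v g : Fin k → H.vertexSet} :
    g ∈ H.transversalTuples v ↔
      (∀ i, g i ∈ H.neighbors (v i)) ∧ (Set.range fun i => (g i : α)) ∈ H.edgeSet := by
  simp [transversalTuples]

/-- Each edge through `v` contributes the m! orderings of its other vertices. -/
theorem factorial_mul_degree_le_card_linkTuples {m : ℕ} (hH : H.IsUniform (m + 1)) (v : α) :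
    m.factorial * H.degree v ≤ (H.linkTuples m v).card := by
  classical
  have hfin : {e ∈ H.edgeSet | v ∈ e}.Finite :=
    (H.vertexSet.toFinite.finite_subsets).subset fun e he => H.subset_vertexSet_of_mem_edgeSet he.1
  have hmaps : ∀ f ∈ H.linkTuples m v,
      insert v (Set.range fun i => (f i : α)) ∈ hfin.toFinset := by
    intro f hf
    rw [mem_linkTuples] at hf
    simpa using hf
  rw [Finset.card_eq_sum_card_fiberwise hmaps, degree, Set.ncard_eq_toFinset_card _ hfin, mul_comm,
    ← smul_eq_mul]
  apply Finset.card_nsmul_le_sum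
  intro e he
  simp only [Set.Finite.mem_toFinset] at he
  obtain ⟨heE, hve⟩ := he
  have heV : e ⊆ H.vertexSet := H.subset_vertexSet_of_mem_edgeSet heE
  have hef : e.Finite := H.vertexSet.toFinite.subset heV
  have hcard : Nat.card ↥(e \ {v}) = m := by
    have := Set.ncard_sdiff_singleton_add_one hve hef
    rw [hH e heE] at this
    rw [Nat.card_coe_set_eq]
    omega
  have : Finite ↥(e \ {v}) := (hef.subset Set.sdiff_subset).to_subtype
  let e₀ : Fin m ≃ ↥(e \ {v}) := (Finite.equivFinOfCardEq hcard).symm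
  have hmem : ∀ x : ↥(e \ {v}), (x : α) ∈ H.vertexSet := fun x => heV x.2.1
  calc m.factorial = (Finset.univ : Finset (Equiv.Perm (Fin m))).card := by
        rw [Finset.card_univ, Fintype.card_perm, Fintype.card_fin]
    _ ≤ _ := by
        refine Finset.card_le_card_of_injOn (fun σ i => ⟨e₀ (σ i), hmem _⟩) ?_ ?_
        · intro σ _
          have hr : (Set.range fun i => ((e₀ (σ i) : ↥(e \ {v})) : α)) = e \ {v} := by
            have : (fun i => ((e₀ (σ i) : ↥(e \ {v})) : α)) = Subtype.val ∘ (σ.trans e₀) := rfl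
            rw [this, Set.range_comp, Equiv.range_eq_univ, Set.image_univ, Subtype.range_coe]
          have hi : insert v (Set.range fun i => ((e₀ (σ i) : ↥(e \ {v})) : α)) = e := by
            rw [hr, Set.insert_sdiff_singleton, Set.insert_eq_of_mem hve]
          simp only [Finset.coe_filter, Set.mem_ofPred_eq, mem_linkTuples]
          rw [hi]
          exact ⟨heE, rfl⟩
        · intro σ _ τ _ h
          ext i
          have := congrFun h i
          simp only [Subtype.mk.injEq] at this
          exact congrArg _ (e₀.injective (Subtype.ext this))

theorem apply_mem_neighbors_of_mem_linkTuples {m : ℕ} (hH : H.IsUniform (m + 1)) {v : α}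
    {f : Fin m → H.vertexSet} (hf : f ∈ H.linkTuples m v) (i : Fin m) :
    f i ∈ H.neighbors v := by
  rw [mem_linkTuples] at hf
  rw [mem_neighbors]
  refine ⟨fun h => ?_, _, hf, Set.mem_insert _ _, Set.mem_insert_of_mem _ ⟨i, rfl⟩⟩
  have h1 := hH _ hf
  rw [Set.insert_eq_of_mem (Set.mem_range.2 ⟨i, h⟩)] at h1
  have h2 : (Set.range fun i => (f i : α)).ncard ≤ m := by
    rw [← Set.image_univ]
    refine (Set.ncard_image_le Set.finite_univ).trans ?_
    simp [Set.ncard_univ]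
  omega

theorem card_linkTuples_le_pow {m : ℕ} (hH : H.IsUniform (m + 1)) (v : α) :
    (H.linkTuples m v).card ≤ (H.neighbors v).card ^ m := by
  classical
  have : H.linkTuples m v ⊆ Fintype.piFinset fun _ => H.neighbors v := fun f hf =>
    Fintype.mem_piFinset.2 fun i => apply_mem_neighbors_of_mem_linkTuples hH hf i
  simpa using Finset.card_le_card this

theorem card_add_card_le_card_inter_add {X : Type*} [Fintype X] [DecidableEq X] (A B : Finset X) :
    A.card + B.card ≤ (A ∩ B).card + Fintype.card X := by
  have h1 := Finset.card_union_add_card_inter A B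
  have h2 := Finset.card_le_univ (A ∪ B)
  omega

variable {m : ℕ} {η : ℝ}

open Classical in
theorem le_card_linkTuples_inter
    (hdeg : ∀ u v : H.vertexSet, u ≠ v → H.Adj u v →
      (1 + η) * (Fintype.card H.vertexSet : ℝ) ^ m ≤
        (H.linkTuples m u).card + (H.linkTuples m v).card)
    {v u : H.vertexSet} (hu : u ∈ H.neighbors v) :
    η * (Fintype.card H.vertexSet : ℝ) ^ m ≤ (H.linkTuples m v ∩ H.linkTuples m u).card := by
  rw [mem_neighbors] at hu
  have h1 := hdeg v u (fun h => hu.1 (by rw [h])) hu.2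
  have h2 := card_add_card_le_card_inter_add (H.linkTuples m v) (H.linkTuples m u)
  rw [Fintype.card_fun, Fintype.card_fin] at h2
  have h3 : ((H.linkTuples m v).card : ℝ) + (H.linkTuples m u).card ≤
    (H.linkTuples m v ∩ H.linkTuples m u).card + (Fintype.card H.vertexSet : ℝ) ^ m := by
    exact_mod_cast h2
  linarith

/-- A single neighbor forces a link of at least η n^m tuples. All of these have entries in the
neighborhood N, and |N|^m ≤ n^(m-1) |N|. -/
theorem le_card_neighbors (hH : H.IsUniform (m + 1)) (hm : m ≠ 0)
    (hdeg : ∀ u v : H.vertexSet, u ≠ v → H.Adj u v →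
      (1 + η) * (Fintype.card H.vertexSet : ℝ) ^ m ≤
        (H.linkTuples m u).card + (H.linkTuples m v).card)
    (hN : ∀ v : H.vertexSet, (H.neighbors v).Nonempty) (v : H.vertexSet) :
    η * (Fintype.card H.vertexSet : ℝ) ≤ (H.neighbors v).card := by
  classical
  obtain ⟨u, hu⟩ := hN v
  have h1 := le_card_linkTuples_inter hdeg hu
  have h2 : ((H.linkTuples m v ∩ H.linkTuples m u).card : ℝ) ≤ (H.neighbors v).card ^ m := by
    exact_mod_cast (Finset.card_le_card Finset.inter_subset_left).trans
      (card_linkTuples_le_pow hH (v : α))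
  have h3 : ((H.neighbors v).card : ℝ) ≤ Fintype.card H.vertexSet := by
    exact_mod_cast Finset.card_le_univ _
  have hn : (0 : ℝ) < Fintype.card H.vertexSet := by
    exact_mod_cast Fintype.card_pos_iff.2 ⟨v⟩
  obtain ⟨l, rfl⟩ := Nat.exists_eq_succ_of_ne_zero hm
  have h4 : ((H.neighbors v).card : ℝ) ^ (l + 1) ≤
      (Fintype.card H.vertexSet : ℝ) ^ l * (H.neighbors v).card := by
    rw [pow_succ]
    gcongr
  have h5 : (Fintype.card H.vertexSet : ℝ) ^ l * (η * Fintype.card H.vertexSet) ≤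
      (Fintype.card H.vertexSet : ℝ) ^ l * (H.neighbors v).card := by
    refine le_trans (le_of_eq ?_) (h1.trans (h2.trans h4))
    rw [Nat.succ_eq_add_one, pow_succ]; ring
  exact le_of_mul_le_mul_left h5 (by positivity)

theorem range_comp_insertNth {β γ : Type*} (c : β → γ) (i₀ : Fin (m + 1)) (u : β)
    (f : Fin m → β) :
    (Set.range fun i => c ((i₀.insertNth u f : Fin (m + 1) → β) i)) =
      insert (c u) (Set.range fun i => c (f i)) := by
  ext x
  simp [Fin.exists_iff_succAbove i₀, eq_comm]

/-- Take `i₀` with the smallest neighborhood. The link of `v i₀` lies in the m-th power of that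
neighborhood, so it is no larger than the product `P` of the other neighborhoods. Hence `P` can
replace this link in the degree condition: each neighbor `u` of `v i₀` has at least η n^m link
tuples inside `P`. -/
theorem le_card_transversalTuples (hH : H.IsUniform (m + 1)) (hm : m ≠ 0) (hη : 0 ≤ η)
    (hdeg : ∀ u v : H.vertexSet, u ≠ v → H.Adj u v →
      (1 + η) * (Fintype.card H.vertexSet : ℝ) ^ m ≤
        (H.linkTuples m u).card + (H.linkTuples m v).card)
    (hN : ∀ v : H.vertexSet, (H.neighbors v).Nonempty) (v : Fin (m + 1) → H.vertexSet) :
    η ^ 2 * (Fintype.card H.vertexSet : ℝ) ^ (m + 1) ≤ (H.transversalTuples v).card := by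
  classical
  obtain ⟨i₀, hi₀⟩ := Finite.exists_min fun i => (H.neighbors (v i)).card
  set P : Finset (Fin m → H.vertexSet) :=
    Fintype.piFinset fun j => H.neighbors (v (i₀.succAbove j)) with hP
  have hPc : (H.linkTuples m (v i₀)).card ≤ P.card := by
    rw [hP, Fintype.card_piFinset]
    refine (card_linkTuples_le_pow hH (v i₀ : α)).trans ?_
    calc (H.neighbors (v i₀)).card ^ m = ∏ _j : Fin m, (H.neighbors (v i₀)).card := by simp
      _ ≤ _ := Finset.prod_le_prod' fun j _ => hi₀ _
  have hfib : ∀ u ∈ H.neighbors (v i₀),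
      η * (Fintype.card H.vertexSet : ℝ) ^ m ≤ (P ∩ H.linkTuples m u).card := by
    intro u hu
    rw [mem_neighbors] at hu
    have h1 := hdeg (v i₀) u (fun h => hu.1 (by rw [h])) hu.2
    have h2 := card_add_card_le_card_inter_add P (H.linkTuples m u)
    rw [Fintype.card_fun, Fintype.card_fin] at h2
    have h3 : (P.card : ℝ) + (H.linkTuples m u).card ≤
      (P ∩ H.linkTuples m u).card + (Fintype.card H.vertexSet : ℝ) ^ m := by exact_mod_cast h2
    have h4 : ((H.linkTuples m (v i₀)).card : ℝ) ≤ P.card := by exact_mod_cast hPc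
    linarith
  have hinj : ((H.neighbors (v i₀)).sigma fun u => P ∩ H.linkTuples m u).card ≤
      (H.transversalTuples v).card := by
    refine Finset.card_le_card_of_injOn (fun p => i₀.insertNth p.1 p.2) ?_ ?_
    · rintro ⟨u, f⟩ hp
      simp only [Finset.mem_coe, Finset.mem_sigma, Finset.mem_inter, hP, Fintype.mem_piFinset,
        mem_linkTuples] at hp
      rw [Finset.mem_coe, mem_transversalTuples]
      refine ⟨?_, ?_⟩
      · rw [Fin.forall_iff_succAbove i₀]
        simpa using ⟨hp.1, hp.2.1⟩
      · have := range_comp_insertNth Subtype.val i₀ u f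
        rw [this]
        exact hp.2.2
    · rintro ⟨u, f⟩ _ ⟨u', f'⟩ _ h
      have h1 : u = u' := by simpa using congrFun h i₀
      have h2 : f = f' := by
        funext j
        simpa using congrFun h (i₀.succAbove j)
      rw [h1, h2]
  rw [Finset.card_sigma] at hinj
  have hinj' : (∑ u ∈ H.neighbors (v i₀), ((P ∩ H.linkTuples m u).card : ℝ)) ≤
    (H.transversalTuples v).card := by exact_mod_cast hinj
  refine le_trans ?_ hinj'
  refine le_trans ?_ (Finset.card_nsmul_le_sum _ _ _ hfib)
  rw [nsmul_eq_mul]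
  have h5 := le_card_neighbors hH hm hdeg hN (v i₀)
  calc η ^ 2 * (Fintype.card H.vertexSet : ℝ) ^ (m + 1)
      = (η * Fintype.card H.vertexSet) * (η * (Fintype.card H.vertexSet : ℝ) ^ m) := by ring
    _ ≤ _ := by gcongr

/-- The first column contributes η², and each of the m + 1 rows one more factor η. -/
theorem le_card_absorbingArrays (hH : H.IsUniform (m + 1)) (hm : m ≠ 0) (hη : 0 ≤ η)
    (hdeg : ∀ u v : H.vertexSet, u ≠ v → H.Adj u v →
      (1 + η) * (Fintype.card H.vertexSet : ℝ) ^ m ≤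
        (H.linkTuples m u).card + (H.linkTuples m v).card)
    (hN : ∀ v : H.vertexSet, (H.neighbors v).Nonempty) (v : Fin (m + 1) → H.vertexSet) :
    η ^ (m + 3) * (Fintype.card H.vertexSet : ℝ) ^ ((m + 1) * (m + 1)) ≤
      (H.absorbingArrays v).card := by
  classical
  have hinj : ((H.transversalTuples v).sigma fun g =>
      Fintype.piFinset fun i => H.linkTuples m (v i) ∩ H.linkTuples m (g i)).card ≤
      (H.absorbingArrays v).card := by
    refine Finset.card_le_card_of_injOn
      (fun p q => (Fin.cons (p.1 q.1) (p.2 q.1) : Fin (m + 1) → H.vertexSet) q.2) ?_ ?_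
    · rintro ⟨g, B⟩ hp
      simp only [Finset.mem_coe, Finset.mem_sigma, Fintype.mem_piFinset] at hp
      simp only [absorbingArrays, Finset.coe_filter, Finset.mem_univ, true_and, Set.mem_ofPred_eq,
        Fin.cons_zero, Fin.cons_succ]
      exact hp
    · rintro ⟨g, B⟩ _ ⟨g', B'⟩ _ h
      have h1 : g = g' := by
        funext i
        simpa using congrFun h (i, 0)
      have h2 : B = B' := by
        funext i j
        simpa using congrFun h (i, j.succ)
      rw [h1, h2]
  rw [Finset.card_sigma] at hinj
  have hinj' : (∑ g ∈ H.transversalTuples v, ((Fintype.piFinset fun i =>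
      H.linkTuples m (v i) ∩ H.linkTuples m (g i)).card : ℝ)) ≤ (H.absorbingArrays v).card := by
    exact_mod_cast hinj
  refine le_trans ?_ hinj'
  have hfib : ∀ g ∈ H.transversalTuples v,
      (η * (Fintype.card H.vertexSet : ℝ) ^ m) ^ (m + 1) ≤ ((Fintype.piFinset fun i =>
        H.linkTuples m (v i) ∩ H.linkTuples m (g i)).card : ℝ) := by
    intro g hg
    rw [mem_transversalTuples] at hg
    rw [Fintype.card_piFinset, Nat.cast_prod]
    calc (η * (Fintype.card H.vertexSet : ℝ) ^ m) ^ (m + 1)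
        = ∏ _i : Fin (m + 1), (η * (Fintype.card H.vertexSet : ℝ) ^ m) := by simp
      _ ≤ _ := Finset.prod_le_prod (fun _ _ => by positivity)
        fun i _ => le_card_linkTuples_inter hdeg (hg.1 i)
  refine le_trans ?_ (Finset.card_nsmul_le_sum _ _ _ hfib)
  rw [nsmul_eq_mul]
  have h5 := le_card_transversalTuples hH hm hη hdeg hN v
  calc η ^ (m + 3) * (Fintype.card H.vertexSet : ℝ) ^ ((m + 1) * (m + 1))
      = (η ^ 2 * (Fintype.card H.vertexSet : ℝ) ^ (m + 1)) *
        (η * (Fintype.card H.vertexSet : ℝ) ^ m) ^ (m + 1) := by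
          rw [mul_pow, ← pow_mul]; ring
    _ ≤ _ := by gcongr

end Hypergraph

/-! ### How disjoint arrays absorb a set -/

namespace Hypergraph

section Matchings

variable {α ι : Type*} {H : Hypergraph α}

theorem isMatching_range {e : ι → Set α} (he : ∀ i, e i ∈ H.edgeSet)
    (hd : Pairwise fun i j => Disjoint (e i) (e j)) : H.IsMatching (Set.range e) := by
  refine ⟨Set.range_subset_iff.2 he, ?_⟩
  rintro _ ⟨i, rfl⟩ _ ⟨j, rfl⟩ hij
  exact hd fun h => hij (by rw [h])

theorem exists_isMatching_sUnion_eq_iUnion {C : ι → Set α}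
    (hd : Pairwise fun i j => Disjoint (C i) (C j))
    (h : ∀ i, ∃ M, H.IsMatching M ∧ ⋃₀ M = C i) :
    ∃ M, H.IsMatching M ∧ ⋃₀ M = ⋃ i, C i := by
  choose M hM hC using h
  refine ⟨⋃ i, M i, ⟨Set.iUnion_subset fun i => (hM i).1, ?_⟩, ?_⟩
  · intro e he f hf hef
    obtain ⟨i, hi⟩ := Set.mem_iUnion.1 he
    obtain ⟨j, hj⟩ := Set.mem_iUnion.1 hf
    by_cases hij : i = j
    · subst hij
      exact (hM i).2 hi hj hef
    · refine (hd hij).mono ?_ ?_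
      · rw [← hC i]; exact Set.subset_sUnion_of_mem hi
      · rw [← hC j]; exact Set.subset_sUnion_of_mem hj
  · rw [Set.sUnion_iUnion]
    exact Set.iUnion_congr hC

end Matchings

variable {α : Type*} {H : Hypergraph α} {m : ℕ}

/-- The set of entries in the `i`-th row of an array of vertices. -/
def row (ω : Fin (m + 1) × Fin (m + 1) → H.vertexSet) (i : Fin (m + 1)) : Set α :=
  Set.range fun j => (ω (i, j) : α)

theorem iUnion_row (ω : Fin (m + 1) × Fin (m + 1) → H.vertexSet) :
    ⋃ i, row ω i = Set.range fun p => (ω p : α) := by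
  ext x
  simp [row]

theorem row_eq_insert (ω : Fin (m + 1) × Fin (m + 1) → H.vertexSet) (i : Fin (m + 1)) :
    row ω i = insert (ω (i, 0) : α) (Set.range fun j : Fin m => (ω (i, j.succ) : α)) := by
  ext x
  simp [row, Fin.exists_fin_succ, eq_comm]

theorem pairwise_disjoint_row {ω : Fin (m + 1) × Fin (m + 1) → H.vertexSet}
    (hω : Function.Injective ω) : Pairwise fun i j => Disjoint (row ω i) (row ω j) := by
  intro i j hij
  rw [Set.disjoint_left]
  rintro _ ⟨a, rfl⟩ ⟨b, hb⟩
  have := hω (Subtype.ext hb)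
  simp only [Prod.mk.injEq] at this
  exact hij this.1.symm

variable [Fintype H.vertexSet]

theorem mem_absorbingArrays {v : Fin (m + 1) → H.vertexSet}
    {ω : Fin (m + 1) × Fin (m + 1) → H.vertexSet} :
    ω ∈ H.absorbingArrays v ↔ (fun i => ω (i, 0)) ∈ H.transversalTuples v ∧
      ∀ i, (fun j : Fin m => ω (i, j.succ)) ∈ H.linkTuples m (v i) ∧
        (fun j : Fin m => ω (i, j.succ)) ∈ H.linkTuples m (ω (i, 0)) := by
  simp [absorbingArrays]

theorem row_mem_edgeSet {v : Fin (m + 1) → H.vertexSet}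
    {ω : Fin (m + 1) × Fin (m + 1) → H.vertexSet} (h : ω ∈ H.absorbingArrays v)
    (i : Fin (m + 1)) : row ω i ∈ H.edgeSet := by
  rw [row_eq_insert, ← mem_linkTuples]
  exact ((mem_absorbingArrays.1 h).2 i).2

theorem exists_isMatching_sUnion_eq_range_union_range {v : Fin (m + 1) → H.vertexSet}
    {ω : Fin (m + 1) × Fin (m + 1) → H.vertexSet} (h : ω ∈ H.absorbingArrays v)
    (hω : Function.Injective ω) (hv : Function.Injective v) (hvω : ∀ i p, v i ≠ ω p) :
    ∃ M, H.IsMatching M ∧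
      ⋃₀ M = (Set.range fun p => (ω p : α)) ∪ Set.range fun i => (v i : α) := by
  rw [mem_absorbingArrays] at h
  let e : Option (Fin (m + 1)) → Set α := fun o => o.elim (Set.range fun i => (ω (i, 0) : α))
    fun i => insert (v i : α) (Set.range fun j : Fin m => (ω (i, j.succ) : α))
  refine ⟨Set.range e, isMatching_range ?_ ?_, ?_⟩
  · rintro (_ | i)
    · exact (mem_transversalTuples.1 h.1).2
    · exact mem_linkTuples.1 (h.2 i).1
  · have h0 : ∀ i, Disjoint (e none) (e (some i)) := by
      intro i
      rw [Set.disjoint_left]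
      rintro _ ⟨a, rfl⟩ (hb | ⟨b, hb⟩)
      · exact hvω i (a, 0) (Subtype.ext hb.symm)
      · have := congrArg Prod.snd (hω (Subtype.ext hb))
        exact Fin.succ_ne_zero _ this
    rintro (_ | i) (_ | j) hij
    · exact absurd rfl hij
    · exact h0 j
    · exact (h0 i).symm
    · have hij' : i ≠ j := fun hh => hij (by rw [hh])
      change Disjoint (e (some i)) (e (some j))
      rw [Set.disjoint_left]
      rintro x (rfl | ⟨a, rfl⟩) (hb | ⟨b, hb⟩)
      · exact hij' (hv (Subtype.ext hb))
      · exact hvω i _ (Subtype.ext hb.symm)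
      · exact hvω j _ (Subtype.ext hb.symm)
      · exact hij' (congrArg Prod.fst (hω (Subtype.ext hb))).symm
  · ext x
    simp only [e, Set.sUnion_range, Set.mem_iUnion, Option.exists, Option.elim, Set.mem_range,
      Set.mem_insert_iff, Set.mem_union, Prod.exists]
    constructor
    · rintro (⟨i, hi⟩ | ⟨i, hi | ⟨j, hj⟩⟩)
      · exact Or.inl ⟨i, 0, hi⟩
      · exact Or.inr ⟨i, hi.symm⟩
      · exact Or.inl ⟨i, j.succ, hj⟩
    · rintro (⟨i, j, hj⟩ | ⟨i, hi⟩)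
      · induction j using Fin.cases with
        | zero => exact Or.inl ⟨i, hj⟩
        | succ j => exact Or.inr ⟨i, Or.inr ⟨j, hj⟩⟩
      · exact Or.inr ⟨i, Or.inl hi.symm⟩

open Classical in
/-- A disjoint family of arrays containing many absorbing arrays for every tuple can absorb every
small set of the right cardinality. -/
theorem exists_isMatching_of_absorbing_family
    {F : Finset (Fin (m + 1) × Fin (m + 1) → H.vertexSet)}
    (hFi : ∀ ω ∈ F, Function.Injective ω)
    (hFa : ∀ ω ∈ F, ∃ v, ω ∈ H.absorbingArrays v)
    (hFd : (F : Set _).PairwiseDisjoint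
      fun ω : Fin (m + 1) × Fin (m + 1) → H.vertexSet => Set.range ω)
    {t : ℕ} (hFt : ∀ v, t ≤ (F.filter fun ω => ω ∈ H.absorbingArrays v).card)
    {V' : Set α} (hV : V' ⊆ H.vertexSet) (hV' : ∀ ω ∈ F, ∀ p, (ω p : α) ∉ V')
    (hcard : V'.ncard = (m + 1) * t) :
    ∃ M, H.IsMatching M ∧ ⋃₀ M = (⋃ ω ∈ F, Set.range fun p => (ω p : α)) ∪ V' := by
  have hfin : V'.Finite := H.vertexSet.toFinite.subset hV
  have : Finite V' := hfin.to_subtype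
  have hc : Nat.card V' = Nat.card (Fin t × Fin (m + 1)) := by
    rw [Nat.card_coe_set_eq, hcard, Nat.card_prod, Nat.card_fin, Nat.card_fin, mul_comm]
  obtain ⟨e⟩ : Nonempty (Fin t × Fin (m + 1) ≃ V') := Finite.card_eq.1 hc.symm
  let w : Fin t → Fin (m + 1) → H.vertexSet := fun j i => ⟨e (j, i), hV (e (j, i)).2⟩
  have hwe : ∀ j i j' i', w j i = w j' i' → j = j' ∧ i = i' := by
    intro j i j' i' hh
    have he : e (j, i) = e (j', i') := Subtype.ext (Subtype.mk.inj hh)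
    simpa using he
  have hwV : ∀ j i, (w j i : α) ∈ V' := fun j i => (e (j, i)).2
  -- Hall's condition is immediate: a single tuple already has `t` candidate arrays, and there are
  -- only `t` tuples.
  obtain ⟨φ, hφi, hφ⟩ := (Finset.all_card_le_biUnion_card_iff_exists_injective
    fun j => F.filter fun ω => ω ∈ H.absorbingArrays (w j)).1 (by
      intro s
      rcases s.eq_empty_or_nonempty with rfl | ⟨j, hj⟩
      · simp
      · refine (Finset.card_le_univ s).trans ?_
        rw [Fintype.card_fin]
        exact (hFt (w j)).trans (Finset.card_le_card (Finset.subset_biUnion_of_mem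
          (fun j => F.filter fun ω => ω ∈ H.absorbingArrays (w j)) hj)))
  have hφF : ∀ j, φ j ∈ F := fun j => (Finset.mem_filter.1 (hφ j)).1
  have hφA : ∀ j, φ j ∈ H.absorbingArrays (w j) := fun j => (Finset.mem_filter.1 (hφ j)).2
  -- Each array is grouped with the tuple assigned to it, if any. These blocks are disjoint and can
  -- be matched separately.
  let C : F → Set α := fun ω => (Set.range fun p => (ω.1 p : α)) ∪
    ⋃ j, ⋃ (_ : φ j = ω.1), Set.range fun i => (w j i : α)
  have hCd : Pairwise fun ω ω' => Disjoint (C ω) (C ω') := by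
    intro ω ω' hne
    have hne' : ω.1 ≠ ω'.1 := fun hh => hne (Subtype.ext hh)
    have hd := Set.disjoint_left.1 (hFd ω.2 ω'.2 hne')
    rw [Set.disjoint_left]
    simp only [C, Set.mem_union, Set.mem_range, Set.mem_iUnion, exists_prop]
    rintro x (⟨p, rfl⟩ | ⟨j, hj, i, rfl⟩) (⟨q, hq⟩ | ⟨j', hj', i', hi'⟩)
    · exact hd ⟨p, rfl⟩ ⟨q, Subtype.ext hq⟩
    · exact hV' _ ω.2 p (hi' ▸ hwV j' i')
    · exact hV' _ ω'.2 q (hq ▸ hwV j i)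
    · have := (hwe _ _ _ _ (Subtype.ext hi')).1
      exact hne' (by rw [← hj, ← hj', this])
  have hC : ∀ ω, ∃ M, H.IsMatching M ∧ ⋃₀ M = C ω := by
    rintro ⟨ω, hωF⟩
    by_cases hex : ∃ j, φ j = ω
    · obtain ⟨j, rfl⟩ := hex
      have hCe : C ⟨φ j, hωF⟩ =
          (Set.range fun p => (φ j p : α)) ∪ Set.range fun i => (w j i : α) := by
        ext x
        simp [C, hφi.eq_iff]
      rw [hCe]
      refine exists_isMatching_sUnion_eq_range_union_range (hφA j) (hFi _ hωF)
        (fun a b hab => (hwe _ _ _ _ hab).2) ?_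
      intro i p hip
      exact hV' _ hωF p (hip ▸ hwV j i)
    · have hCe : C ⟨ω, hωF⟩ = Set.range fun p => (ω p : α) := by
        push Not at hex
        simp [C, hex]
      rw [hCe, ← iUnion_row, ← Set.sUnion_range]
      obtain ⟨v, hv⟩ := hFa ω hωF
      exact ⟨_, isMatching_range (row_mem_edgeSet hv) (pairwise_disjoint_row (hFi ω hωF)), rfl⟩
  obtain ⟨M, hM, hMC⟩ := exists_isMatching_sUnion_eq_iUnion hCd hC
  refine ⟨M, hM, hMC.trans ?_⟩
  ext x
  simp only [C, Set.mem_iUnion, Set.mem_union, Set.mem_range, exists_prop, Subtype.exists]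
  constructor
  · rintro ⟨ω, hω, ⟨p, hp⟩ | ⟨j, hj, i, hi⟩⟩
    · exact Or.inl ⟨ω, hω, p, hp⟩
    · exact Or.inr (hi ▸ hwV j i)
  · rintro (⟨ω, hω, p, hp⟩ | hx)
    · exact ⟨ω, hω, Or.inl ⟨p, hp⟩⟩
    · refine ⟨φ (e.symm ⟨x, hx⟩).1, hφF _, Or.inr ⟨_, rfl, (e.symm ⟨x, hx⟩).2, ?_⟩⟩
      simp [w]

end Hypergraph

/-! ### Numerical estimates -/

-- Lowering 2ε to 3ε/2 pays for replacing the falling factorial by n^m.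
open Filter Topology Asymptotics in
theorem eventually_mul_pow_le_mul_factorial_mul_choose (m : ℕ) {ε : ℝ} (hε : 0 < ε) :
    ∀ᶠ n : ℕ in atTop, (1 + 3 / 2 * ε) * (n : ℝ) ^ m ≤
      (1 + 2 * ε) * (m.factorial * n.choose m : ℝ) := by
  have h := (isEquivalent_descFactorial m).isLittleO.bound
    (show 0 < (ε / 2) / (1 + 2 * ε) by positivity)
  filter_upwards [h] with n hn
  have h1 : (n.descFactorial m : ℝ) = m.factorial * n.choose m := by
    exact_mod_cast Nat.descFactorial_eq_factorial_mul_choose n m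
  simp only [Pi.sub_apply, Real.norm_eq_abs, h1, abs_of_nonneg (pow_nonneg n.cast_nonneg m :
    (0 : ℝ) ≤ (n : ℝ) ^ m)] at hn
  have h2 := (abs_le.1 hn).1
  have h3 : (1 + 2 * ε) * ((ε / 2) / (1 + 2 * ε) * (n : ℝ) ^ m) = ε / 2 * (n : ℝ) ^ m := by
    field_simp
  nlinarith [mul_le_mul_of_nonneg_left h2 (show 0 ≤ 1 + 2 * ε by positivity)]

-- The left power decays like exp(-3c²n/(2k)), while the right side is at least exp(-c²n/k). The
-- surplus exp(-c²n/(2k)) beats n^k and the constant lost to the floor.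
open Filter Topology in
theorem eventually_pow_mul_pow_floor_le {k : ℕ} (hk : 0 < k) {c : ℝ} (hc : 0 < c)
    (hc' : c ≤ 2 / 3) :
    ∀ᶠ n : ℕ in atTop, (n : ℝ) ^ k * (1 - 3 * c / 2) ^ ⌊c * n / k⌋₊ ≤
      (1 / 2) ^ ⌊c ^ 2 * n / k⌋₊ := by
  have hk' : (0 : ℝ) < k := by exact_mod_cast hk
  have hr : Real.exp (-(c ^ 2 / (2 * k))) < 1 := by
    rw [Real.exp_lt_one_iff]
    have : 0 < c ^ 2 / (2 * k) := by positivity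
    linarith
  have h := (tendsto_pow_const_mul_const_pow_of_lt_one k (Real.exp_pos _).le hr).eventually_le_const
    (Real.exp_pos (-(3 * c / 2)))
  filter_upwards [h] with n hn
  have h1 : (1 - 3 * c / 2) ^ ⌊c * n / k⌋₊ ≤ Real.exp (-(3 * c / 2) * (c * n / k - 1)) := by
    calc (1 - 3 * c / 2) ^ ⌊c * n / k⌋₊ ≤ Real.exp (-(3 * c / 2)) ^ ⌊c * n / k⌋₊ := by
          apply pow_le_pow_left₀ (by linarith)
          have := Real.add_one_le_exp (-(3 * c / 2))
          linarith
      _ = Real.exp (-(3 * c / 2) * ⌊c * n / k⌋₊) := by rw [← Real.exp_nat_mul, mul_comm]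
      _ ≤ _ := by
          apply Real.exp_le_exp.2
          have := Nat.lt_floor_add_one (c * n / k)
          nlinarith
  have h2 : Real.exp (-(c ^ 2 * n / k)) ≤ (1 / 2) ^ ⌊c ^ 2 * n / k⌋₊ := by
    calc Real.exp (-(c ^ 2 * n / k)) ≤ Real.exp (-(⌊c ^ 2 * n / k⌋₊ : ℝ)) := by
          apply Real.exp_le_exp.2
          have := Nat.floor_le (show 0 ≤ c ^ 2 * n / k by positivity)
          linarith
      _ = Real.exp (-1) ^ ⌊c ^ 2 * n / k⌋₊ := by rw [← Real.exp_nat_mul]; simp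
      _ ≤ _ := by
          apply pow_le_pow_left₀ (Real.exp_pos _).le
          rw [Real.exp_neg, ← one_div]
          apply one_div_le_one_div_of_le (by norm_num)
          have := Real.add_one_le_exp (1 : ℝ)
          linarith
  calc (n : ℝ) ^ k * (1 - 3 * c / 2) ^ ⌊c * n / k⌋₊
      ≤ (n : ℝ) ^ k * Real.exp (-(3 * c / 2) * (c * n / k - 1)) := by gcongr
    _ = ((n : ℝ) ^ k * Real.exp (-(c ^ 2 / (2 * k))) ^ n) * Real.exp (3 * c / 2) *
          Real.exp (-(c ^ 2 * n / k)) := by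
        rw [← Real.exp_nat_mul, mul_assoc, mul_assoc, ← Real.exp_add, ← Real.exp_add]
        congr 2
        field_simp
        ring
    _ ≤ Real.exp (-(3 * c / 2)) * Real.exp (3 * c / 2) * Real.exp (-(c ^ 2 * n / k)) := by gcongr
    _ = Real.exp (-(c ^ 2 * n / k)) := by rw [← Real.exp_add]; simp
    _ ≤ _ := h2

/-- Raising k by one multiplies the left side by at most 5 · 16 = 80 and the right side by 81. -/
theorem cube_add_four_mul_two_pow_le {k : ℕ} (hk : 3 ≤ k) :
    (k ^ 3 + 4) * 2 ^ (4 * k + 1) ≤ 3 ^ (4 * k + 1) := by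
  induction k, hk using Nat.le_induction with
  | base => norm_num
  | succ k hk ih =>
    have h1 : (k + 1) ^ 3 + 4 ≤ 5 * (k ^ 3 + 4) := by nlinarith [Nat.mul_le_mul hk hk, sq_nonneg k]
    calc ((k + 1) ^ 3 + 4) * 2 ^ (4 * (k + 1) + 1)
        ≤ 5 * (k ^ 3 + 4) * 2 ^ (4 * (k + 1) + 1) := Nat.mul_le_mul_right _ h1
      _ = 80 * ((k ^ 3 + 4) * 2 ^ (4 * k + 1)) := by
          rw [show 4 * (k + 1) + 1 = 4 * k + 1 + 4 by ring, pow_add 2 (4 * k + 1) 4]; ring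
      _ ≤ 81 * 3 ^ (4 * k + 1) := Nat.mul_le_mul (by norm_num) ih
      _ = 3 ^ (4 * (k + 1) + 1) := by
          rw [show 4 * (k + 1) + 1 = 4 * k + 1 + 4 by ring, pow_add 3 (4 * k + 1) 4]; ring

theorem cube_add_four_mul_pow_le {k : ℕ} (hk : 3 ≤ k) {ε : ℝ} (hε : 0 < ε) (hε' : 3 / 2 * ε ≤ 1) :
    ((k : ℝ) ^ 3 + 4) * ε ^ (4 * k + 1) ≤ (3 / 2 * ε) ^ (k + 2) := by
  have h1 : ((k : ℝ) ^ 3 + 4) * 2 ^ (4 * k + 1) ≤ 3 ^ (4 * k + 1) := by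
    exact_mod_cast cube_add_four_mul_two_pow_le hk
  calc ((k : ℝ) ^ 3 + 4) * ε ^ (4 * k + 1)
      = ((k : ℝ) ^ 3 + 4) * 2 ^ (4 * k + 1) * (ε / 2) ^ (4 * k + 1) := by
        rw [mul_assoc, ← mul_pow]; congr 2; ring
    _ ≤ 3 ^ (4 * k + 1) * (ε / 2) ^ (4 * k + 1) := by gcongr
    _ = (3 / 2 * ε) ^ (4 * k + 1) := by rw [← mul_pow]; congr 1; ring
    _ ≤ (3 / 2 * ε) ^ (k + 2) := pow_le_pow_of_le_one (by positivity) hε' (by omega)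

/-! ### Assembling the absorbing matching -/

namespace Hypergraph

theorem neighbors_nonempty {α : Type*} {H : Hypergraph α} [Fintype H.vertexSet] {k : ℕ}
    (hH : H.IsUniform k) (hk : 2 ≤ k) (v : H.vertexSet) (hv : ¬ H.IsIsolated (v : α)) :
    (H.neighbors v).Nonempty := by
  simp only [IsIsolated, not_forall, not_not] at hv
  obtain ⟨e, he, hve⟩ := hv
  obtain ⟨u, hue, huv⟩ := Set.exists_ne_of_one_lt_ncard (by rw [hH e he]; omega : 1 < e.ncard) (v : α)
  exact ⟨⟨u, H.subset_vertexSet_of_mem_edgeSet he hue⟩, mem_neighbors.2 ⟨huv, e, he, hve, hue⟩⟩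

-- The factor η^(m+3) - c is the room for arrays that repeat a vertex or meet `U`.
open Classical in
theorem le_card_filter_injective_disjoint {α : Type*} {H : Hypergraph α} [Fintype H.vertexSet]
    [Nonempty H.vertexSet] {m : ℕ} {η c : ℝ}
    (hH : H.IsUniform (m + 1)) (hm : m ≠ 0) (hη : 0 ≤ η)
    (hdeg : ∀ u v : H.vertexSet, u ≠ v → H.Adj u v →
      (1 + η) * (Fintype.card H.vertexSet : ℝ) ^ m ≤
        (H.linkTuples m u).card + (H.linkTuples m v).card)
    (hN : ∀ v : H.vertexSet, (H.neighbors v).Nonempty) (U : Finset H.vertexSet)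
    (hU : (((m + 1) * (m + 1)) ^ 2 + ((m + 1) * (m + 1)) * U.card : ℝ) ≤
      (η ^ (m + 3) - c) * Fintype.card H.vertexSet) (v : Fin (m + 1) → H.vertexSet) :
    c * Fintype.card (Fin (m + 1) × Fin (m + 1) → H.vertexSet) ≤
      ((((H.absorbingArrays v).filter Function.Injective).filter fun ω =>
        Disjoint (Finset.univ.image ω) U).card : ℝ) := by
  set n := Fintype.card H.vertexSet with hn
  have hn0 : (0 : ℝ) < n := by exact_mod_cast Fintype.card_pos
  have hbad := card_filter_not_injective_or_mem_mul_card_le (ι := Fin (m + 1) × Fin (m + 1)) U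
  simp only [Fintype.card_prod, Fintype.card_fin, ← hn] at hbad
  set B := Finset.univ.filter fun f : Fin (m + 1) × Fin (m + 1) → H.vertexSet =>
    ¬ (Function.Injective f ∧ ∀ a, f a ∉ U) with hB
  set G := ((H.absorbingArrays v).filter Function.Injective).filter fun ω =>
    Disjoint (Finset.univ.image ω) U with hG
  have hsub : H.absorbingArrays v ⊆ G ∪ B := by
    intro ω hω
    by_cases hg : Function.Injective ω ∧ ∀ a, ω a ∉ U
    · refine Finset.mem_union_left _ ?_
      simp only [hG, Finset.mem_filter]
      refine ⟨⟨hω, hg.1⟩, Finset.disjoint_left.2 ?_⟩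
      intro x hx
      obtain ⟨a, -, rfl⟩ := Finset.mem_image.1 hx
      exact hg.2 a
    · exact Finset.mem_union_right _ (by simpa [hB] using hg)
  have h1 : ((H.absorbingArrays v).card : ℝ) ≤ G.card + B.card := by
    exact_mod_cast (Finset.card_le_card hsub).trans (Finset.card_union_le _ _)
  have h2 := le_card_absorbingArrays hH hm hη hdeg hN v
  rw [← hn] at h2
  have hbad' : (B.card : ℝ) * n ≤ (((m + 1) * (m + 1)) ^ 2 + ((m + 1) * (m + 1)) * U.card) *
      (n : ℝ) ^ ((m + 1) * (m + 1)) := by exact_mod_cast hbad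
  have h3 : (B.card : ℝ) ≤ (η ^ (m + 3) - c) * (n : ℝ) ^ ((m + 1) * (m + 1)) := by
    refine le_of_mul_le_mul_right ?_ hn0
    refine hbad'.trans ((mul_le_mul_of_nonneg_right hU (by positivity)).trans (le_of_eq (by ring)))
  have h4 : (Fintype.card (Fin (m + 1) × Fin (m + 1) → H.vertexSet) : ℝ) =
      (n : ℝ) ^ ((m + 1) * (m + 1)) := by
    rw [Fintype.card_fun, Fintype.card_prod, Fintype.card_fin, ← hn]; push_cast; rfl
  rw [h4]
  linarith

open Classical in
/-- There are few pairwise disjoint arrays among which every tuple has many absorbing ones. -/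
theorem exists_absorbing_family {α : Type*} {H : Hypergraph α} [Fintype H.vertexSet]
    [Nonempty H.vertexSet] {m N t : ℕ} {η δ : ℝ} (hδ : δ ≤ 1)
    (hH : H.IsUniform (m + 1)) (hm : m ≠ 0) (hη : 0 ≤ η)
    (hdeg : ∀ u v : H.vertexSet, u ≠ v → H.Adj u v →
      (1 + η) * (Fintype.card H.vertexSet : ℝ) ^ m ≤
        (H.linkTuples m u).card + (H.linkTuples m v).card)
    (hN : ∀ v : H.vertexSet, (H.neighbors v).Nonempty)
    (hNδ : (((m + 1) * (m + 1)) ^ 2 * (N + 1) : ℝ) ≤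
      (η ^ (m + 3) - δ) * Fintype.card H.vertexSet)
    (ht : (Fintype.card H.vertexSet : ℝ) ^ (m + 1) * (1 - δ / 2) ^ N ≤ (1 / 2) ^ t) :
    ∃ F : Finset (Fin (m + 1) × Fin (m + 1) → H.vertexSet), F.card ≤ N ∧
      (∀ ω ∈ F, Function.Injective ω) ∧ (∀ ω ∈ F, ∃ v, ω ∈ H.absorbingArrays v) ∧
      ((F : Set _).PairwiseDisjoint
        fun ω : Fin (m + 1) × Fin (m + 1) → H.vertexSet => Set.range ω) ∧
      ∀ v, t ≤ (F.filter fun ω => ω ∈ H.absorbingArrays v).card := by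
  obtain ⟨F, hFc, hFA, hFd, hFs⟩ := exists_greedy_disjoint_family
    (fun v : Fin (m + 1) → H.vertexSet => (H.absorbingArrays v).filter Function.Injective)
    (fun ω => Finset.univ.image ω) (b := (m + 1) * (m + 1)) (N := N)
    (fun ω => Finset.univ_nonempty.image ω)
    (fun ω => Finset.card_image_le.trans (by simp)) hδ (by
      intro U hU v
      refine le_card_filter_injective_disjoint hH hm hη hdeg hN U (le_trans ?_ hNδ) v
      have hU' : (U.card : ℝ) ≤ N * ((m + 1) * (m + 1)) := by exact_mod_cast hU
      nlinarith [mul_le_mul_of_nonneg_left hU'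
        (show (0 : ℝ) ≤ (m + 1) * (m + 1) by positivity)]) N le_rfl
  refine ⟨F, hFc, ?_, ?_, ?_, ?_⟩
  · intro ω hω
    obtain ⟨v, hv⟩ := hFA ω hω
    exact (Finset.mem_filter.1 hv).2
  · intro ω hω
    obtain ⟨v, hv⟩ := hFA ω hω
    exact ⟨v, (Finset.mem_filter.1 hv).1⟩
  · intro ω hω ω' hω' hne
    have := hFd hω hω' hne
    simp only [Function.onFun] at this ⊢
    rw [← Finset.disjoint_coe] at this
    simpa using this
  · intro v
    -- A single term is at most the whole potential, which forces the exponent of each tuple up to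
    -- `t`.
    have h1 : (1 / 2 : ℝ) ^ (F ∩ (H.absorbingArrays v).filter Function.Injective).card ≤
        (1 / 2) ^ t := by
      refine le_trans ?_ ht
      refine le_trans ?_ (hFs.trans (le_of_eq ?_))
      · exact Finset.single_le_sum (f := fun v => (1 / 2 : ℝ) ^
          (F ∩ (H.absorbingArrays v).filter Function.Injective).card)
          (fun _ _ => by positivity) (Finset.mem_univ v)
      · rw [Fintype.card_fun, Fintype.card_fin]; push_cast; rfl
    rw [pow_le_pow_iff_right_of_lt_one₀ (by norm_num) (by norm_num)] at h1
    refine h1.trans (Finset.card_le_card ?_)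
    intro ω hω
    rw [Finset.mem_inter, Finset.mem_filter] at hω
    exact Finset.mem_filter.2 ⟨hω.1, hω.2.1⟩

theorem exists_absorbing_matching {α : Type*} {H : Hypergraph α} [Fintype H.vertexSet]
    [Nonempty H.vertexSet] {m N t : ℕ} {η δ : ℝ} (hδ : δ ≤ 1)
    (hH : H.IsUniform (m + 1)) (hm : m ≠ 0) (hη : 0 ≤ η)
    (hdeg : ∀ u v : H.vertexSet, u ≠ v → H.Adj u v →
      (1 + η) * (Fintype.card H.vertexSet : ℝ) ^ m ≤
        (H.linkTuples m u).card + (H.linkTuples m v).card)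
    (hN : ∀ v : H.vertexSet, (H.neighbors v).Nonempty)
    (hNδ : (((m + 1) * (m + 1)) ^ 2 * (N + 1) : ℝ) ≤
      (η ^ (m + 3) - δ) * Fintype.card H.vertexSet)
    (ht : (Fintype.card H.vertexSet : ℝ) ^ (m + 1) * (1 - δ / 2) ^ N ≤ (1 / 2) ^ t) :
    ∃ M : Set (Set α), H.IsMatching M ∧ M.ncard ≤ N * (m + 1) ∧
      ∀ V' : Set α, V' ⊆ H.vertexSet → Disjoint V' (⋃₀ M) → V'.ncard ≤ (m + 1) * t →
        m + 1 ∣ V'.ncard → ∃ M' : Set (Set α), H.IsMatching M' ∧ ⋃₀ M' = ⋃₀ M ∪ V' := by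
  classical
  obtain ⟨F, hFc, hFi, hFa, hFd, hFt⟩ := exists_absorbing_family hδ hH hm hη hdeg hN hNδ ht
  let e : F × Fin (m + 1) → Set α := fun p => row p.1.1 p.2
  have heU : ⋃₀ Set.range e = ⋃ ω ∈ F, Set.range fun p => (ω p : α) := by
    simp only [e, Set.sUnion_range, Set.iUnion_prod', iUnion_row]
    exact Set.iUnion_subtype (fun ω => ω ∈ F) _
  refine ⟨Set.range e, isMatching_range ?_ ?_, ?_, ?_⟩
  · rintro ⟨⟨ω, hω⟩, i⟩
    obtain ⟨v, hv⟩ := hFa ω hω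
    exact row_mem_edgeSet hv i
  · rintro ⟨⟨ω, hω⟩, i⟩ ⟨⟨ω', hω'⟩, j⟩ hne
    by_cases hωω' : ω = ω'
    · subst hωω'
      exact pairwise_disjoint_row (hFi ω hω) fun hij => hne (Prod.ext rfl hij)
    · have hd := Set.disjoint_left.1 (hFd hω hω' hωω')
      rw [Set.disjoint_left]
      rintro _ ⟨a, rfl⟩ ⟨b, hb⟩
      exact hd ⟨(i, a), rfl⟩ ⟨(j, b), Subtype.ext hb⟩
  · rw [← Set.image_univ]
    refine (Set.ncard_image_le Set.finite_univ).trans ?_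
    rw [Set.ncard_univ, Nat.card_eq_fintype_card, Fintype.card_prod, Fintype.card_coe,
      Fintype.card_fin]
    exact Nat.mul_le_mul_right _ hFc
  · rintro V' hV hVd hVc ⟨t', ht'⟩
    rw [heU] at hVd ⊢
    refine exists_isMatching_of_absorbing_family hFi hFa hFd (t := t') ?_ hV ?_ ht'
    · intro v
      rw [ht'] at hVc
      exact (Nat.le_of_mul_le_mul_left hVc (Nat.succ_pos m)).trans (hFt v)
    · intro ω hω p hp
      exact Set.disjoint_left.1 hVd hp (Set.mem_biUnion hω ⟨p, rfl⟩)

end Hypergraph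

open Filter in
theorem lemma3p3 (k : ℕ) (hk : 3 ≤ k) (ε : ℝ) (hε : 0 < ε) :
    ∃ n₀ : ℕ, ∀ n : ℕ, n₀ ≤ n →
      ∀ (α : Type*) (H : Hypergraph α),
        H.vertexSet.Finite → H.vertexSet.ncard = n → H.IsUniform k →
        (∀ v ∈ H.vertexSet, ¬ H.IsIsolated v) →
        (∀ u v : α, u ≠ v → H.Adj u v →
          (1 + 2 * ε) * (n.choose (k - 1) : ℝ) < (H.degree u : ℝ) + (H.degree v : ℝ)) →
        ∃ M : Set (Set α), H.IsMatching M ∧ (M.ncard : ℝ) ≤ ε ^ (4 * k + 1) * (n : ℝ) ∧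
          ∀ V' : Set α, V' ⊆ H.vertexSet → Disjoint V' (⋃₀ M) →
            (V'.ncard : ℝ) ≤ ε ^ (8 * k + 2) * (n : ℝ) → k ∣ V'.ncard →
            ∃ M' : Set (Set α), H.IsMatching M' ∧ ⋃₀ M' = ⋃₀ M ∪ V' := by
  obtain ⟨m, rfl⟩ : ∃ m, k = m + 1 := ⟨k - 1, by omega⟩
  rw [Nat.add_sub_cancel]
  set c : ℝ := ε ^ (4 * (m + 1) + 1) with hc
  have hc0 : 0 < c := by positivity
  have hc2 : ε ^ (8 * (m + 1) + 2) = c ^ 2 := by rw [hc, ← pow_mul]; congr 1; ring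
  -- The threshold is fixed before any hypergraph is given, so c ≤ 2/3 is kept as a premise until
  -- `hδ` supplies it.
  have hfloor : ∀ᶠ n : ℕ in atTop, c ≤ 2 / 3 →
      (n : ℝ) ^ (m + 1) * (1 - 3 * c / 2) ^ ⌊c * n / (m + 1 : ℕ)⌋₊ ≤
        (1 / 2) ^ ⌊c ^ 2 * n / (m + 1 : ℕ)⌋₊ := by
    by_cases h : c ≤ 2 / 3
    · simpa [h] using eventually_pow_mul_pow_floor_le (Nat.succ_pos m) hc0 h
    · exact Eventually.of_forall fun n hn => absurd hn h
  obtain ⟨n₀, hn₀⟩ := eventually_atTop.1 ((eventually_gt_atTop 0).and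
    ((eventually_mul_pow_le_mul_factorial_mul_choose m hε).and (hfloor.and
      (tendsto_natCast_atTop_atTop.eventually_ge_atTop (((m + 1 : ℝ) ^ 4) / c)))))
  refine ⟨n₀, fun n hn α H hfin hcard hH hiso hdeg => ?_⟩
  obtain ⟨hnpos, hchoose, hpot, hlarge⟩ := hn₀ n hn
  have hnpos' : (0 : ℝ) < n := by exact_mod_cast hnpos
  let _ : Fintype H.vertexSet := hfin.fintype
  have hcardV : Fintype.card H.vertexSet = n := by
    rw [← hcard, ← Nat.card_coe_set_eq, Nat.card_eq_fintype_card]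
  have : Nonempty H.vertexSet := Fintype.card_pos_iff.1 (by omega)
  have hN : ∀ v : H.vertexSet, (H.neighbors v).Nonempty := fun v =>
    Hypergraph.neighbors_nonempty hH (by omega) v (hiso v v.2)
  have hlink : ∀ u v : H.vertexSet, u ≠ v → H.Adj u v →
      (1 + 3 / 2 * ε) * (Fintype.card H.vertexSet : ℝ) ^ m ≤
        (H.linkTuples m u).card + (H.linkTuples m v).card := by
    intro u v huv hadj
    have h1 := hdeg u v (fun h => huv (Subtype.ext h)) hadj
    have h2 : (m.factorial * H.degree u : ℝ) ≤ (H.linkTuples m u).card := by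
      exact_mod_cast Hypergraph.factorial_mul_degree_le_card_linkTuples hH (u : α)
    have h3 : (m.factorial * H.degree v : ℝ) ≤ (H.linkTuples m v).card := by
      exact_mod_cast Hypergraph.factorial_mul_degree_le_card_linkTuples hH (v : α)
    have h4 := mul_le_mul_of_nonneg_left h1.le (Nat.cast_nonneg (α := ℝ) m.factorial)
    rw [hcardV]
    linarith
  -- Smallness of ε is forced by the hypergraph: a vertex has at least (3ε/2) n neighbors, and at
  -- most n.
  have hε1 : 3 / 2 * ε ≤ 1 := by
    obtain ⟨v⟩ := this
    have h1 := Hypergraph.le_card_neighbors hH (by omega) hlink hN v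
    have h2 : ((H.neighbors v).card : ℝ) ≤ Fintype.card H.vertexSet := by
      exact_mod_cast Finset.card_le_univ _
    rw [hcardV] at h1 h2
    exact le_of_mul_le_mul_right ((h1.trans h2).trans_eq (one_mul _).symm) hnpos'
  have hgap := cube_add_four_mul_pow_le hk hε hε1
  rw [← hc] at hgap
  have hη1 : (3 / 2 * ε) ^ (m + 1 + 2) ≤ 1 := pow_le_one₀ (by positivity) hε1
  push_cast at hgap
  have hm3 : (0 : ℝ) ≤ (m + 1 : ℝ) ^ 3 * c := by positivity
  have hδ : 3 * c ≤ 1 := by linarith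
  have hk0 : (0 : ℝ) < ((m + 1 : ℕ) : ℝ) := by positivity
  set N := ⌊c * n / (m + 1 : ℕ)⌋₊ with hNdef
  have hNle : (N : ℝ) * (m + 1) ≤ c * n := by
    have := Nat.floor_le (show 0 ≤ c * n / (m + 1 : ℕ) by positivity)
    rw [← hNdef, le_div_iff₀ hk0] at this
    exact_mod_cast this
  obtain ⟨M, hM, hMc, hMa⟩ := Hypergraph.exists_absorbing_matching (N := N)
    (t := ⌊c ^ 2 * n / (m + 1 : ℕ)⌋₊) hδ hH (by omega) (by positivity) hlink hN (by
      rw [hcardV]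
      rw [div_le_iff₀ hc0] at hlarge
      -- Here k³c comes from the used vertices, c from the lower-order term (n ≥ k⁴/c) and 3c from
      -- δ, which explains the constant k³ + 4 in `hgap`.
      calc (((m + 1) * (m + 1)) ^ 2 * (N + 1) : ℝ)
          = (m + 1) ^ 3 * (N * (m + 1)) + (m + 1) ^ 4 := by ring
        _ ≤ (m + 1) ^ 3 * (c * n) + n * c := by gcongr
        _ = (((m + 1) ^ 3 + 4) * c - 3 * c) * n := by ring
        _ ≤ _ := by gcongr) (by
      rw [hcardV]
      exact hpot (by linarith))
  refine ⟨M, hM, ?_, ?_⟩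
  · refine le_trans ?_ hNle
    exact_mod_cast hMc
  · intro V' hV hVd hVc hdvd
    refine hMa V' hV hVd ?_ hdvd
    obtain ⟨t', ht'⟩ := hdvd
    rw [ht']
    apply Nat.mul_le_mul_left
    apply Nat.le_floor
    rw [le_div_iff₀ hk0, ← hc2]
    rw [ht'] at hVc
    push_cast at hVc ⊢
    linarith
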